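/- Let $A\not\equiv 0$ be a polynomial, $q$ an entire function, $\mathbb T=\{|z|=1\}$, and let $\mathcal Z_A$ be the (finite) zero set of $zA(z)$. Let $\nu$ be a generalized semiclassical weight: $\nu$ is a holomorphic, nowhere vanishing function on an open set $\Omega$ with $\mathbb T\setminus\mathcal Z_A\subseteq\Omega\subseteq\mathbb C\setminus\mathcal Z_A$ (so $\Omega=\mathbb C\setminus\mathcal Z_A$ if $\nu$ is single-valued, and otherwise branch cuts are removed), and $$zA(z)\,\nu'(z)=q(z)\,\nu(z),\qquad z\in\Omega .$$ The weight also has values at the points of $\mathbb T\cap\mathcal Z_A$ where it is not singular. Let $S\subseteq\mathbb T\cap\mathcal Z_A$ be the set of singular points of the weight on $\mathbb T$ ($S=\emptyset$ for a Hölder continuous weight). Let $n\ge 0$ be an integer and let $Y_n$ be a $2\times2$ matrix function that solves the Riemann–Hilbert problem: 1. $Y_n$ is holomorphic in $\mathbb C\setminus\mathbb T$; 2. $Y_n$ has continuous boundary values $(Y_n)_+$ (from $|z|<1$) and $(Y_n)_-$ (from $|z|>1$) on $\mathbb T\setminus S$, with $(Y_n)_+(t)=(Y_n)_-(t)\begin{bmatrix}1&\nu(t)/t^n\\0&1\end{bmatrix}$;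 as $z\to c\in S$, $z\notin\mathbb T$, the first column of $Y_n$ is $O(1)$ and the second one is $o(|z-c|^{-1})$; 3. $Y_n(z)=\big(I_2+O(z^{-1})\big)\begin{bmatrix}z^n&0\\0&z^{-n}\end{bmatrix}$ as $z\to\infty$. Put $Z_n=Y_nC_n$ with $C_n(z)=\begin{bmatrix}z^{-n/2}\nu(z)^{1/2}&0\\0&z^{n/2}\nu(z)^{-1/2}\end{bmatrix}$, for any local holomorphic branches of the square roots. Then, at every point of $\Omega\setminus\mathbb T$, $Z_n$ is differentiable and invertible, and the structure matrix $M_n=Z_n'Z_n^{-1}$ does not depend on the branches and extends to a function that is holomorphic in $\mathbb C\setminus\mathcal Z_A$. In particular, $M_n$ has at most an isolated singularity at each point of $\mathcal Z_A$. -/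

import Mathlib

open Filter Topology Asymptotics

namespace UnitCircleRH

/-- The unit circle `𝕋`. -/
abbrev circ : Set ℂ := Metric.sphere (0 : ℂ) 1

/-- The zero set of the polynomial `z A(z)`. -/
def zeroSet (A : Polynomial ℂ) : Set ℂ := {z | z * A.eval z = 0}

/-- `ν` is a generalized semiclassical weight: `z A(z) ν'(z) = q(z) ν(z)` off the zeros of `z A(z)`,
with `A` a (nonzero) polynomial and `q` entire.

`ν` may be multivalued in the plane (for example `(-z)^β (1 - z)^α`), so it is given as a
holomorphic nowhere vanishing branch on an open set `Ω` that avoids the zeros of `z A(z)` and contains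
every other point of the circle.  If `ν` is single-valued, `Ω` is the whole complement of
`zeroSet A`; in general it is this complement with branch cuts removed.  On `Ω ∩ 𝕋` the function `ν` is
the weight of orthogonality itself. -/
structure IsGeneralizedSemiclassical (A : Polynomial ℂ) (q ν : ℂ → ℂ) (Ω : Set ℂ) : Prop where
  ne_zero : A ≠ 0
  entire : Differentiable ℂ q
  isOpen : IsOpen Ω
  subset_compl : Ω ⊆ (zeroSet A)ᶜ
  circ_subset : circ \ zeroSet A ⊆ Ω
  holomorphic : DifferentiableOn ℂ ν Ω
  weight_ne_zero : ∀ z ∈ Ω, ν z ≠ 0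
  pearson : ∀ z ∈ Ω, z * A.eval z * deriv ν z = q z * ν z

/-- `Y` solves the Riemann–Hilbert problem of index `n` for the weight `ν` on the unit circle.
`S` is the set of points of the circle at which the weight is singular; for a Hölder continuous
weight `S = ∅`, and `jump` is then required on the whole circle and `endpoint` is void.  At a singular
point of the weight there are no boundary values, and the customary local condition takes their
place: the first column stays bounded, and the second one (a Cauchy integral of the
weight) is `o(1/|z - c|)`, as is the case for every singularity `|z - c| ^ a` with `-1 < a`. -/
structure IsRHSolution (n : ℕ) (ν : ℂ → ℂ) (S : Set ℂ) (Y : ℂ → Matrix (Fin 2) (Fin 2) ℂ) :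
    Prop where
  holomorphic : ∀ i j, DifferentiableOn ℂ (fun z => Y z i j) circᶜ
  jump : ∃ Yp Ym : ℂ → Matrix (Fin 2) (Fin 2) ℂ,
    ContinuousOn Yp (circ \ S) ∧ ContinuousOn Ym (circ \ S) ∧
    ∀ t ∈ circ \ S,
      Tendsto Y (𝓝[{z | ‖z‖ < 1}] t) (𝓝 (Yp t)) ∧
      Tendsto Y (𝓝[{z | 1 < ‖z‖}] t) (𝓝 (Ym t)) ∧
      Yp t = Ym t * !![1, ν t / t ^ n; 0, 1]
  endpoint : ∀ c ∈ S, ∀ i,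
    (fun z => Y z i 0) =O[𝓝[circᶜ] c] (fun _ => (1 : ℂ)) ∧
    (fun z => Y z i 1) =o[𝓝[circᶜ] c] (fun z => (z - c)⁻¹)
  infinity : ∃ R : ℂ → Matrix (Fin 2) (Fin 2) ℂ,
    (∀ i j, (fun z => R z i j) =O[Bornology.cobounded ℂ] (fun z => z⁻¹)) ∧
    ∀ᶠ z in Bornology.cobounded ℂ, Y z = (1 + R z) * !![z ^ n, 0; 0, (z ^ n)⁻¹]

/-- `r` is, near `z`, a holomorphic branch of the square root of `f`. -/
def IsSqrtBranchAt (f r : ℂ → ℂ) (z : ℂ) : Prop :=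
  AnalyticAt ℂ r z ∧ ∀ᶠ w in 𝓝 z, r w ^ 2 = f w

/-- The matrix `C_n(z) = diag (z^{-n/2} / ν^{-1/2}, z^{n/2} / ν^{1/2})`, where `r` is a branch of
`z^{1/2}` and `s` a branch of `ν^{1/2}`. -/
noncomputable def cMatrix (n : ℕ) (r s : ℂ → ℂ) (z : ℂ) : Matrix (Fin 2) (Fin 2) ℂ :=
  !![(r z ^ n)⁻¹ / (s z)⁻¹, 0; 0, r z ^ n / s z]

/-- The fundamental matrix `Z_n = Y_n C_n`. -/
noncomputable def zMatrix (n : ℕ) (Y : ℂ → Matrix (Fin 2) (Fin 2) ℂ) (r s : ℂ → ℂ) (z : ℂ) :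
    Matrix (Fin 2) (Fin 2) ℂ :=
  Y z * cMatrix n r s z

/-- The entrywise complex derivative of a matrix function. -/
noncomputable def matDeriv (Z : ℂ → Matrix (Fin 2) (Fin 2) ℂ) (z : ℂ) :
    Matrix (Fin 2) (Fin 2) ℂ :=
  Matrix.of fun i j => deriv (fun w => Z w i j) z

end UnitCircleRH

open UnitCircleRH

/-!
The matrix `Z_n = Y_n C_n` has a constant jump across the circle, so its logarithmic derivative
does not jump at all. To see this without square roots, let `l` be the logarithmic derivative of
`ν(z) / z ^ n`, which by the Pearson equation is meromorphic with poles in `zeroSet A` only. Then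
`C_n' C_n⁻¹ = (l / 2) σ₃`, so that `Z_n' Z_n⁻¹` is the gauge transform of `(l / 2) σ₃` by `Y_n`, and
the jump matrix of `Y_n` is a gauge transformation that fixes `(l / 2) σ₃`. Undoing the jump outside
the disk therefore does not change `Z_n' Z_n⁻¹`, while it continues `Y_n` across the circle: a
function that is continuous across a circle and holomorphic off it is holomorphic. The continued
matrix is invertible because `det Y_n` has no jump and only removable singularities, so that it is
entire and equals `1` by Liouville's theorem.
-/

namespace UnitCircleRH

open Metric Set
open scoped Interval Matrix.Norms.L2Operator Ring

section Painleve

variable {E : Type*} [NormedAddCommGroup E] [NormedSpace ℂ E] {f : ℂ → E} {a b c d e x₀ : ℝ}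

/-- The integral of `f` along the positively oriented boundary of the rectangle with lower left
vertex `a + c i` and upper right vertex `b + d i`. -/
noncomputable def rectBoundaryIntegral (f : ℂ → E) (a b c d : ℝ) : E :=
  (∫ x in a..b, f (x + c * Complex.I)) - (∫ x in a..b, f (x + d * Complex.I)) +
    Complex.I • (∫ y in c..d, f (b + y * Complex.I)) -
    Complex.I • (∫ y in c..d, f (a + y * Complex.I))

theorem rectBoundaryIntegral_add (hf : ContinuousOn f ([[a, e]] ×ℂ [[c, d]]))
    (hb : b ∈ [[a, e]]) :
    rectBoundaryIntegral f a b c d + rectBoundaryIntegral f b e c d =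
      rectBoundaryIntegral f a e c d := by
  have hint : ∀ y ∈ [[c, d]], ∀ x₁ x₂ : ℝ, [[x₁, x₂]] ⊆ [[a, e]] →
      IntervalIntegrable (fun x : ℝ => f (x + y * Complex.I)) MeasureTheory.volume x₁ x₂ :=
    fun y hy x₁ x₂ hx => (hf.comp (by fun_prop) fun x hx' =>
      ⟨by simpa using hx hx', by simpa using hy⟩).intervalIntegrable
  have hadd : ∀ y ∈ [[c, d]], (∫ x in a..b, f (x + y * Complex.I)) +
      (∫ x in b..e, f (x + y * Complex.I)) = ∫ x in a..e, f (x + y * Complex.I) := fun y hy =>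
    intervalIntegral.integral_add_adjacent_intervals
      (hint y hy a b (uIcc_subset_uIcc_left hb)) (hint y hy b e (uIcc_subset_uIcc_right hb))
  simp only [rectBoundaryIntegral, ← hadd c left_mem_uIcc, ← hadd d right_mem_uIcc]
  abel

theorem rectBoundaryIntegral_eq_zero_of_re_ne (hf : ContinuousOn f ([[a, b]] ×ℂ [[c, d]]))
    (hd : ∀ z ∈ [[a, b]] ×ℂ [[c, d]], z.re ≠ x₀ → DifferentiableAt ℂ f z) :
    rectBoundaryIntegral f a b c d = 0 := by
  have off_line : ∀ a' b' : ℝ, [[a', b']] ⊆ [[a, b]] → x₀ ∉ Ioo (min a' b') (max a' b') →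
      rectBoundaryIntegral f a' b' c d = 0 := by
    intro a' b' hsub hx₀
    have hrect : [[a', b']] ×ℂ [[c, d]] ⊆ [[a, b]] ×ℂ [[c, d]] := fun z hz => ⟨hsub hz.1, hz.2⟩
    simpa [rectBoundaryIntegral] using
      Complex.integral_boundary_rect_eq_zero_of_continuousOn_of_differentiableOn f
        (a' + c * Complex.I) (b' + d * Complex.I) (by simpa using hf.mono hrect) fun z hz => by
          simp only [Complex.add_re, Complex.ofReal_re, Complex.mul_re, Complex.I_re, mul_zero,
            Complex.ofReal_im, Complex.I_im, mul_one, sub_self, add_zero, Complex.add_im,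
            Complex.mul_im, zero_add] at hz
          exact (hd z (hrect ⟨Ioo_subset_Icc_self hz.1, Ioo_subset_Icc_self hz.2⟩)
            (ne_of_mem_of_not_mem hz.1 hx₀)).differentiableWithinAt
  by_cases hx₀ : x₀ ∈ Ioo (min a b) (max a b)
  · have hx₀' : x₀ ∈ [[a, b]] := Ioo_subset_Icc_self hx₀
    rw [← rectBoundaryIntegral_add hf hx₀', off_line a x₀ (uIcc_subset_uIcc_left hx₀') (by grind),
      off_line x₀ b (uIcc_subset_uIcc_right hx₀') (by grind), add_zero]
  · exact off_line a b subset_rfl hx₀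

theorem differentiableOn_of_continuousOn_of_re_ne [CompleteSpace E] {U : Set ℂ} (hU : IsOpen U)
    (hf : ContinuousOn f U) (hd : ∀ z ∈ U, z.re ≠ x₀ → DifferentiableAt ℂ f z) :
    DifferentiableOn ℂ f U := by
  refine (Complex.isConservativeOn_and_continuousOn_iff_isDifferentiableOn hU).1
    ⟨fun z w hzw => ?_, hf⟩
  rw [← add_eq_zero_iff_eq_neg, Complex.wedgeIntegral_add_wedgeIntegral_eq]
  exact rectBoundaryIntegral_eq_zero_of_re_ne (hf.mono hzw) fun z hz => hd z (hzw hz)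

end Painleve

theorem eqOn_extendFrom_of_dense {X Y : Type*} [TopologicalSpace X] [TopologicalSpace Y]
    [T2Space Y] {D V : Set X} (hD : Dense D) (hV : IsOpen V) {f : X → Y}
    (hf : ContinuousOn f V) : EqOn (extendFrom D f) f V := fun x hx =>
  extendFrom_eq (hD x) <|
    (hf.continuousAt (hV.mem_nhds hx)).tendsto.mono_left nhdsWithin_le_nhds

theorem isLittleO_nhdsNE_of_dense {X E F : Type*} [TopologicalSpace X]
    [NormedAddCommGroup E] [NormedAddCommGroup F] {D : Set X} (hD : Dense D) {x : X} {f : X → E}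
    {g : X → F}
    (hf : ∀ᶠ y in 𝓝[≠] x, ContinuousAt f y) (hg : ∀ᶠ y in 𝓝[≠] x, ContinuousAt g y)
    (h : f =o[𝓝[D] x] g) : f =o[𝓝[≠] x] g := by
  refine isLittleO_iff.2 fun ε hε => ?_
  have hbound : ∀ᶠ y in 𝓝 x, ∀ᶠ w in 𝓝[D] y, ‖f w‖ ≤ ε * ‖g w‖ :=
    eventually_nhds_nhdsWithin.2 (isLittleO_iff.1 h hε)
  filter_upwards [hf, hg, hbound.filter_mono nhdsWithin_le_nhds] with y hfy hgy hy
  have : (𝓝[D] y).NeBot := mem_closure_iff_nhdsWithin_neBot.1 (hD y)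
  exact le_of_tendsto_of_tendsto (hfy.norm.tendsto.mono_left nhdsWithin_le_nhds)
    ((hgy.norm.const_mul ε).tendsto.mono_left nhdsWithin_le_nhds) hy

theorem dense_compl_sphere {E : Type*} [NormedAddCommGroup E] [NormedSpace ℝ E] [Nontrivial E]
    (c : E) (R : ℝ) : Dense (sphere c R)ᶜ :=
  interior_eq_empty_iff_dense_compl.1 (interior_sphere' c R)

section Sphere

variable {E : Type*} [NormedAddCommGroup E] [NormedSpace ℂ E] [CompleteSpace E]
  {f : ℂ → E} {U S : Set ℂ} {c : ℂ} {R : ℝ}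

theorem differentiableOn_of_continuousOn_of_sdiff_sphere (hR : R ≠ 0) (hU : IsOpen U)
    (hf : ContinuousOn f U) (hd : DifferentiableOn ℂ f (U \ sphere c R)) :
    DifferentiableOn ℂ f U := by
  have hopen : IsOpen (U \ sphere c R) := hU.sdiff isClosed_sphere
  refine fun t ht => DifferentiableAt.differentiableWithinAt ?_
  by_cases htc : t ∈ sphere c R
  swap
  · exact hd.differentiableAt (hopen.mem_nhds ⟨ht, htc⟩)
  have ht0 : t - c ≠ 0 := sub_ne_zero.2 (ne_of_mem_sphere htc hR)
  -- `w ↦ c + (t - c) exp w` carries the imaginary axis onto the circle.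
  let φ : ℂ → ℂ := fun w => c + (t - c) * Complex.exp w
  have hφ : Differentiable ℂ φ := by fun_prop
  have hφ_axis : ∀ w, w.re ≠ 0 → φ w ∉ sphere c R := by
    intro w hw
    rw [mem_sphere_iff_norm] at htc
    simpa [φ, Complex.norm_exp, htc, hR] using hw
  have hfφ : DifferentiableOn ℂ (f ∘ φ) (φ ⁻¹' U) :=
    differentiableOn_of_continuousOn_of_re_ne (hU.preimage hφ.continuous)
      (hf.comp hφ.continuous.continuousOn fun _ h => h) fun w hw hre =>
        (hd.differentiableAt (hopen.mem_nhds ⟨hw, hφ_axis w hre⟩)).comp w (hφ w)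
  let ψ : ℂ → ℂ := fun z => Complex.log ((z - c) / (t - c))
  have hψ : DifferentiableAt ℂ ψ t :=
    DifferentiableAt.clog (by fun_prop) (by simp [ht0])
  have hφψ : ∀ᶠ z in 𝓝 t, φ (ψ z) = z := by
    filter_upwards [eventually_ne_nhds (sub_ne_zero.1 ht0)] with z hz
    simp only [φ, ψ]
    rw [Complex.exp_log (div_ne_zero (sub_ne_zero.2 hz) ht0), mul_div_cancel₀ _ ht0,
      add_sub_cancel]
  have hmem : ψ t ∈ φ ⁻¹' U := by rwa [mem_preimage, hφψ.self_of_nhds]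
  refine ((hfφ.differentiableAt
    ((hU.preimage hφ.continuous).mem_nhds hmem)).comp t hψ).congr_of_eventuallyEq ?_
  filter_upwards [hφψ] with z hz
  rw [Function.comp_apply, Function.comp_apply, hz]

theorem differentiableOn_extendFrom_compl_sphere (hR : R ≠ 0) (hU : IsOpen U)
    (hf : DifferentiableOn ℂ f (U \ sphere c R))
    (hlim : ∀ t ∈ U ∩ sphere c R, ∃ y, Tendsto f (𝓝[(sphere c R)ᶜ] t) (𝓝 y)) :
    DifferentiableOn ℂ (extendFrom (sphere c R)ᶜ f) U := by
  refine differentiableOn_of_continuousOn_of_sdiff_sphere hR hU ?_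
    (hf.congr (eqOn_extendFrom_of_dense (dense_compl_sphere c R) (hU.sdiff isClosed_sphere)
      hf.continuousOn))
  refine continuousOn_extendFrom (fun z _ => dense_compl_sphere c R z) fun z hz => ?_
  by_cases hzc : z ∈ sphere c R
  · exact hlim z ⟨hz, hzc⟩
  · exact ⟨f z, (hf.continuousOn.continuousAt
      ((hU.sdiff isClosed_sphere).mem_nhds ⟨hz, hzc⟩)).tendsto.mono_left nhdsWithin_le_nhds⟩

theorem differentiableOn_extendFrom_compl_sphere_of_isLittleO (hR : R ≠ 0) (hU : IsOpen U)
    (hS : S.Finite) (hf : DifferentiableOn ℂ f (U \ sphere c R))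
    (hlim : ∀ t ∈ U ∩ sphere c R, t ∉ S → ∃ y, Tendsto f (𝓝[(sphere c R)ᶜ] t) (𝓝 y))
    (ho : ∀ t ∈ U ∩ sphere c R, t ∈ S → f =o[𝓝[(sphere c R)ᶜ] t] fun z => (z - t)⁻¹) :
    DifferentiableOn ℂ (extendFrom (sphere c R)ᶜ f) U := by
  set F := extendFrom (sphere c R)ᶜ f
  have hopen : IsOpen (U \ S) := hU.sdiff hS.isClosed
  have hF : DifferentiableOn ℂ F (U \ S) :=
    differentiableOn_extendFrom_compl_sphere hR hopen
      (hf.mono (sdiff_subset_sdiff_left sdiff_subset)) fun t ht => hlim t ⟨ht.1.1, ht.2⟩ ht.1.2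
  refine differentiableOn_extendFrom_compl_sphere hR hU hf fun t ht => ?_
  by_cases htS : t ∈ S
  swap
  · exact hlim t ht htS
  have hFt : ∀ᶠ z in 𝓝[≠] t, DifferentiableAt ℂ F z := by
    filter_upwards [mem_nhdsWithin_of_mem_nhds (hU.mem_nhds ht.1),
      nhdsNE_le_cofinite t hS.compl_mem_cofinite] with z hzU hzS
    exact hF.differentiableAt (hopen.mem_nhds ⟨hzU, hzS⟩)
  have hinv : ∀ᶠ z in 𝓝[≠] t, ContinuousAt (fun z : ℂ => (z - t)⁻¹) z := by
    filter_upwards [self_mem_nhdsWithin] with z hz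
    exact ContinuousAt.inv₀ (by fun_prop) (sub_ne_zero.2 hz)
  have hFf : F =ᶠ[𝓝[(sphere c R)ᶜ] t] f := by
    filter_upwards [self_mem_nhdsWithin, mem_nhdsWithin_of_mem_nhds (hU.mem_nhds ht.1)]
      with z hz hzU
    exact eqOn_extendFrom_of_dense (dense_compl_sphere c R) (hU.sdiff isClosed_sphere)
      hf.continuousOn ⟨hzU, hz⟩
  have hFo : F =o[𝓝[≠] t] fun z => (z - t)⁻¹ :=
    isLittleO_nhdsNE_of_dense (dense_compl_sphere c R) (hFt.mono fun _ h => h.continuousAt) hinv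
      (hFf.trans_isLittleO (ho t ht htS))
  have hconst : (fun _ => F t) =o[𝓝[≠] t] fun z => (z - t)⁻¹ :=
    IsBoundedUnder.isLittleO_sub_self_inv isBoundedUnder_const
  have hsub : (sphere c R)ᶜ ⊆ {t}ᶜ := compl_subset_compl.2 (singleton_subset_iff.2 ht.2)
  exact ⟨_, ((Complex.tendsto_limUnder_of_differentiable_on_punctured_nhds_of_isLittleO hFt
    (hFo.sub hconst)).mono_left (nhdsWithin_mono t hsub)).congr' hFf⟩

end Sphere

section GaugeTransform

variable {𝕜 𝔸 : Type*} [NontriviallyNormedField 𝕜] [NormedRing 𝔸] [NormedAlgebra 𝕜 𝔸]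
  {Y J : 𝕜 → 𝔸} {z : 𝕜}

/-- The gauge transform `Y' Y⁻¹ + Y B Y⁻¹` of a connection coefficient `B` by `Y` at the point `z`:
if `W' = B W`, then `Y W` solves the equation with this coefficient. It equals the logarithmic
derivative `Y' Y⁻¹` for `B = 0`. The inverse is `Ring.inverse`, which is `0` at noninvertible
elements. -/
noncomputable def gaugeTransform (Y : 𝕜 → 𝔸) (z : 𝕜) (B : 𝔸) : 𝔸 :=
  (deriv Y z + Y z * B) * (Y z)⁻¹ʳ

theorem gaugeTransform_zero (Y : 𝕜 → 𝔸) (z : 𝕜) :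
    gaugeTransform Y z 0 = deriv Y z * (Y z)⁻¹ʳ := by
  rw [gaugeTransform, mul_zero, add_zero]

theorem gaugeTransform_mul (hY : DifferentiableAt 𝕜 Y z) (hJ : DifferentiableAt 𝕜 J z)
    (hJu : IsUnit (J z)) (B : 𝔸) :
    gaugeTransform (fun w => Y w * J w) z B = gaugeTransform Y z (gaugeTransform J z B) := by
  simp only [gaugeTransform]
  rw [deriv_fun_mul hY hJ, Ring.inverse_mul (Or.inr hJu), ← mul_assoc]
  congr 1
  rw [add_assoc, mul_assoc (Y z), ← mul_add, add_mul, Ring.mul_inverse_cancel_right _ _ hJu,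
    mul_assoc (Y z)]

theorem gaugeTransform_congr (h : Y =ᶠ[𝓝 z] J) : gaugeTransform Y z = gaugeTransform J z := by
  funext B
  rw [gaugeTransform, gaugeTransform, h.deriv_eq, h.eq_of_nhds]

theorem differentiableAt_gaugeTransform [CompleteSpace 𝔸] [CompleteSpace 𝕜] {B : 𝕜 → 𝔸}
    (hY : AnalyticAt 𝕜 Y z) (hYu : IsUnit (Y z)) (hB : DifferentiableAt 𝕜 B z) :
    DifferentiableAt 𝕜 (fun w => gaugeTransform Y w (B w)) z :=
  (hY.deriv.differentiableAt.fun_add (hY.differentiableAt.fun_mul hB)).fun_mul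
    (hY.differentiableAt.inverse hYu)

end GaugeTransform

theorem logDeriv_eq_half_of_sq_eventuallyEq {𝕜 : Type*} [NontriviallyNormedField 𝕜] [CharZero 𝕜]
    {f g : 𝕜 → 𝕜} {z : 𝕜} (hf : DifferentiableAt 𝕜 f z) (h : ∀ᶠ w in 𝓝 z, f w ^ 2 = g w) :
    logDeriv f z = logDeriv g z / 2 := by
  have hsq : (fun w => f w ^ 2) =ᶠ[𝓝 z] g := h
  have hlog := logDeriv_fun_pow hf 2
  rw [logDeriv_apply, hsq.deriv_eq, hsq.eq_of_nhds, ← logDeriv_apply] at hlog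
  rw [hlog, Nat.cast_ofNat, mul_div_cancel_left₀ _ two_ne_zero]

section Entries

variable {𝕜 F m n : Type*} [NontriviallyNormedField 𝕜] [NormedAddCommGroup F] [NormedSpace 𝕜 F]
  [Finite m] [Finite n] {Z : 𝕜 → Matrix m n F} {z : 𝕜}

theorem hasDerivAt_matrix_iff {Z' : Matrix m n F} :
    HasDerivAt Z Z' z ↔ ∀ i j, HasDerivAt (fun w => Z w i j) (Z' i j) z := by
  cases nonempty_fintype m
  cases nonempty_fintype n
  exact (hasDerivAt_pi (φ := Z) (φ' := Z')).trans (forall_congr' fun _ => hasDerivAt_pi)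

theorem differentiableAt_matrix_iff :
    DifferentiableAt 𝕜 Z z ↔ ∀ i j, DifferentiableAt 𝕜 (fun w => Z w i j) z := by
  cases nonempty_fintype m
  cases nonempty_fintype n
  exact differentiableAt_pi.trans (forall_congr' fun _ => differentiableAt_pi)

theorem differentiableOn_matrix_iff {s : Set 𝕜} :
    DifferentiableOn 𝕜 Z s ↔ ∀ i j, DifferentiableOn 𝕜 (fun w => Z w i j) s := by
  cases nonempty_fintype m
  cases nonempty_fintype n
  exact differentiableOn_pi.trans (forall_congr' fun _ => differentiableOn_pi)

end Entries

section Matrix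

variable {Z : ℂ → Matrix (Fin 2) (Fin 2) ℂ} {h α : ℂ → ℂ} {z : ℂ}

theorem matDeriv_eq_deriv (hZ : DifferentiableAt ℂ Z z) : matDeriv Z z = deriv Z z :=
  Matrix.ext fun i j => (hasDerivAt_matrix_iff.1 hZ.hasDerivAt i j).deriv

/-- The third Pauli matrix, the direction of the logarithmic derivative of `diag (α, α⁻¹)`. -/
def sigmaThree : Matrix (Fin 2) (Fin 2) ℂ := !![1, 0; 0, -1]

theorem hasDerivAt_upperUnipotent {h' : ℂ} (hh : HasDerivAt h h' z) :
    HasDerivAt (fun w => !![1, h w; 0, 1]) !![0, h'; 0, 0] z := by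
  refine hasDerivAt_matrix_iff.2 fun i j => ?_
  fin_cases i <;> fin_cases j <;> simp [hh, hasDerivAt_const]

theorem isUnit_upperUnipotent (b : ℂ) : IsUnit !![1, b; 0, 1] := by
  simp [Matrix.isUnit_iff_isUnit_det]

theorem gaugeTransform_upperUnipotent {l : ℂ} (hh : HasDerivAt h (l * h z) z) :
    gaugeTransform (fun w => !![1, h w; 0, 1]) z ((l / 2) • sigmaThree) =
      (l / 2) • sigmaThree := by
  symm
  rw [gaugeTransform, (hasDerivAt_upperUnipotent hh).deriv,
    Ring.eq_mul_inverse_iff_mul_eq _ _ _ (isUnit_upperUnipotent _)]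
  have upper_right : l / 2 * h z = l * h z + -(h z * (l / 2)) := by ring
  ext i j
  fin_cases i <;> fin_cases j <;> simp [sigmaThree, Matrix.mul_apply, upper_right]

theorem hasDerivAt_diagonal_inv {α' : ℂ} (hα : HasDerivAt α α' z) (h0 : α z ≠ 0) :
    HasDerivAt (fun w => !![α w, 0; 0, (α w)⁻¹]) !![α', 0; 0, -α' / α z ^ 2] z := by
  refine hasDerivAt_matrix_iff.2 fun i j => ?_
  fin_cases i <;> fin_cases j <;> simp [hα, hasDerivAt_const, hα.fun_inv h0]

theorem isUnit_diagonal_inv {a : ℂ} (ha : a ≠ 0) : IsUnit !![a, 0; 0, a⁻¹] := by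
  simp [Matrix.isUnit_iff_isUnit_det, ha]

theorem gaugeTransform_diagonal_inv (hα : DifferentiableAt ℂ α z) (h0 : α z ≠ 0) :
    gaugeTransform (fun w => !![α w, 0; 0, (α w)⁻¹]) z 0 = logDeriv α z • sigmaThree := by
  symm
  rw [gaugeTransform_zero, (hasDerivAt_diagonal_inv hα.hasDerivAt h0).deriv,
    Ring.eq_mul_inverse_iff_mul_eq _ _ _ (isUnit_diagonal_inv h0)]
  ext i j
  fin_cases i <;> fin_cases j <;> simp [sigmaThree, Matrix.mul_apply, logDeriv_apply] <;>
    field_simp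

end Matrix

theorem nhdsWithin_compl_circ (t : ℂ) :
    𝓝[circᶜ] t = 𝓝[{z | ‖z‖ < 1}] t ⊔ 𝓝[{z | 1 < ‖z‖}] t := by
  rw [← nhdsWithin_union]
  congr 1
  ext z
  simp [lt_or_lt_iff_ne]

theorem zeroSet_finite {A : Polynomial ℂ} (hA : A ≠ 0) : (zeroSet A).Finite := by
  simpa [zeroSet, Polynomial.IsRoot] using
    Polynomial.finite_setOfPred_isRoot (mul_ne_zero Polynomial.X_ne_zero hA)

/-- The logarithmic derivative of `ν(z) / z ^ n`, as prescribed by the Pearson equation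
`z A(z) ν'(z) = q(z) ν(z)`; unlike `ν`, it is defined on the whole complement of `zeroSet A`. -/
noncomputable def weightLogDeriv (A : Polynomial ℂ) (q : ℂ → ℂ) (n : ℕ) (z : ℂ) : ℂ :=
  q z / (z * A.eval z) - n / z

/-- The function `ν(z) / z ^ n` outside the unit disk, continued by `0` to the disk.
Multiplication of `Y` by the upper unipotent matrix with this entry removes its jump. -/
noncomputable def exteriorWeight (n : ℕ) (ν : ℂ → ℂ) (z : ℂ) : ℂ :=
  if ‖z‖ < 1 then 0 else ν z / z ^ n

section Weight

variable {A : Polynomial ℂ} {q ν : ℂ → ℂ} {Ω : Set ℂ} {z : ℂ}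

theorem differentiableAt_weightLogDeriv (hq : DifferentiableAt ℂ q z) (n : ℕ)
    (hz : z ∉ zeroSet A) : DifferentiableAt ℂ (weightLogDeriv A q n) z := by
  have hzA : z * A.eval z ≠ 0 := hz
  have hz0 : z ≠ 0 := left_ne_zero_of_mul hzA
  exact (hq.fun_div (differentiableAt_id.fun_mul A.differentiable.differentiableAt) hzA).fun_sub
    ((differentiableAt_const _).fun_div differentiableAt_id hz0)

theorem IsGeneralizedSemiclassical.ne_zero_of_mem (hν : IsGeneralizedSemiclassical A q ν Ω)
    (hz : z ∈ Ω) : z ≠ 0 :=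
  left_ne_zero_of_mul (b := A.eval z) (hν.subset_compl hz)

theorem IsGeneralizedSemiclassical.div_pow_ne_zero (hν : IsGeneralizedSemiclassical A q ν Ω)
    (n : ℕ) (hz : z ∈ Ω) : ν z / z ^ n ≠ 0 :=
  div_ne_zero (hν.weight_ne_zero z hz) (pow_ne_zero n (hν.ne_zero_of_mem hz))

theorem IsGeneralizedSemiclassical.differentiableAt_div_pow
    (hν : IsGeneralizedSemiclassical A q ν Ω) (n : ℕ) (hz : z ∈ Ω) :
    DifferentiableAt ℂ (fun w => ν w / w ^ n) z :=
  (hν.holomorphic.differentiableAt (hν.isOpen.mem_nhds hz)).fun_div (differentiableAt_pow n)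
    (pow_ne_zero n (hν.ne_zero_of_mem hz))

theorem IsGeneralizedSemiclassical.logDeriv_div_pow
    (hν : IsGeneralizedSemiclassical A q ν Ω) (n : ℕ) (hz : z ∈ Ω) :
    logDeriv (fun w => ν w / w ^ n) z = weightLogDeriv A q n z := by
  have hz0 := hν.ne_zero_of_mem hz
  have hzA : z * A.eval z ≠ 0 := hν.subset_compl hz
  rw [logDeriv_div (g := fun w => w ^ n) z (hν.weight_ne_zero z hz) (pow_ne_zero n hz0)
    (hν.holomorphic.differentiableAt (hν.isOpen.mem_nhds hz)) (differentiableAt_pow n),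
    logDeriv_pow, weightLogDeriv, logDeriv_apply]
  congr 1
  rw [div_eq_div_iff (hν.weight_ne_zero z hz) hzA, ← hν.pearson z hz, mul_comm]

theorem IsGeneralizedSemiclassical.hasDerivAt_exteriorWeight
    (hν : IsGeneralizedSemiclassical A q ν Ω) (n : ℕ) (hz : z ∈ Ω) (hzc : z ∉ circ) :
    HasDerivAt (exteriorWeight n ν) (weightLogDeriv A q n z * exteriorWeight n ν z) z := by
  rcases lt_or_gt_of_ne (mt mem_sphere_zero_iff_norm.2 hzc) with hlt | hgt
  · rw [exteriorWeight, if_pos hlt, mul_zero]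
    refine (hasDerivAt_const z 0).congr_of_eventuallyEq ?_
    filter_upwards [continuous_norm.continuousAt.eventually_lt_const hlt] with w hw using if_pos hw
  · rw [exteriorWeight, if_neg hgt.not_gt, ← hν.logDeriv_div_pow n hz, logDeriv_apply,
      div_mul_cancel₀ _ (hν.div_pow_ne_zero n hz)]
    refine (hν.differentiableAt_div_pow n hz).hasDerivAt.congr_of_eventuallyEq ?_
    filter_upwards [continuous_norm.continuousAt.eventually_const_lt hgt] with w hw
      using if_neg (lt_asymm hw)

theorem IsSqrtBranchAt.ne_zero {f r : ℂ → ℂ} (hr : IsSqrtBranchAt f r z) (hf : f z ≠ 0) :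
    r z ≠ 0 :=
  ne_zero_pow two_ne_zero (hr.2.self_of_nhds ▸ hf)

theorem IsSqrtBranchAt.logDeriv_eq {f r : ℂ → ℂ} (hr : IsSqrtBranchAt f r z) :
    logDeriv r z = logDeriv f z / 2 :=
  logDeriv_eq_half_of_sq_eventuallyEq hr.1.differentiableAt hr.2

end Weight

section RiemannHilbert

variable {A : Polynomial ℂ} {q ν : ℂ → ℂ} {Ω S : Set ℂ} {n : ℕ}
  {Y : ℂ → Matrix (Fin 2) (Fin 2) ℂ} {z t : ℂ}

namespace IsRHSolution

theorem differentiableOn (hY : IsRHSolution n ν S Y) : DifferentiableOn ℂ Y circᶜ :=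
  differentiableOn_matrix_iff.2 hY.holomorphic

theorem analyticAt (hY : IsRHSolution n ν S Y) (hz : z ∉ circ) : AnalyticAt ℂ Y z :=
  hY.differentiableOn.analyticAt (isClosed_sphere.isOpen_compl.mem_nhds hz)

theorem differentiableAt (hY : IsRHSolution n ν S Y) (hz : z ∉ circ) : DifferentiableAt ℂ Y z :=
  (hY.analyticAt hz).differentiableAt

theorem exists_tendsto_det (hY : IsRHSolution n ν S Y) (ht : t ∈ circ \ S) :
    ∃ d, Tendsto (fun z => (Y z).det) (𝓝[circᶜ] t) (𝓝 d) := by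
  obtain ⟨Yp, Ym, -, -, hjump⟩ := hY.jump
  obtain ⟨hp, hm, hpm⟩ := hjump t ht
  have hdet : (Yp t).det = (Ym t).det := by
    rw [hpm, Matrix.det_mul, Matrix.det_fin_two_of]
    simp
  have hcont : Continuous fun B : Matrix (Fin 2) (Fin 2) ℂ => B.det := continuous_id.matrix_det
  rw [nhdsWithin_compl_circ]
  exact ⟨(Yp t).det, ((hcont.tendsto _).comp hp).sup (hdet ▸ (hcont.tendsto _).comp hm)⟩

theorem isLittleO_det (hY : IsRHSolution n ν S Y) (ht : t ∈ S) :
    (fun z => (Y z).det) =o[𝓝[circᶜ] t] fun z => (z - t)⁻¹ := by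
  have hdiag := (hY.endpoint t ht 0).1.mul_isLittleO (hY.endpoint t ht 1).2
  have hanti := (hY.endpoint t ht 1).1.mul_isLittleO (hY.endpoint t ht 0).2
  simp only [one_mul] at hdiag hanti
  refine (hdiag.sub hanti).congr_left fun z => ?_
  rw [Matrix.det_fin_two]
  ring

theorem tendsto_det_cobounded (hY : IsRHSolution n ν S Y) :
    Tendsto (fun z => (Y z).det) (Bornology.cobounded ℂ) (𝓝 1) := by
  obtain ⟨R, hR, hYR⟩ := hY.infinity
  have hR0 : Tendsto R (Bornology.cobounded ℂ) (𝓝 0) :=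
    tendsto_pi_nhds.2 fun i => tendsto_pi_nhds.2 fun j =>
      (hR i j).trans_tendsto tendsto_inv₀_cobounded
  have hdet : Tendsto (fun z => (1 + R z).det) (Bornology.cobounded ℂ) (𝓝 1) := by
    simpa [Function.comp_def] using
      ((continuous_id.matrix_det (n := Fin 2)).tendsto _).comp (hR0.const_add 1)
  refine hdet.congr' ?_
  filter_upwards [hYR, Bornology.eventually_ne_cobounded 0] with z hz hz0
  rw [hz, Matrix.det_mul, Matrix.det_fin_two_of, mul_inv_cancel₀ (pow_ne_zero n hz0)]
  ring

theorem det_eq_one (hY : IsRHSolution n ν S Y) (hS : S.Finite) (hz : z ∉ circ) :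
    (Y z).det = 1 := by
  set G := extendFrom circᶜ fun z => (Y z).det
  have hd : DifferentiableOn ℂ (fun z => (Y z).det) circᶜ := by
    simp only [Matrix.det_fin_two]
    exact ((hY.holomorphic 0 0).fun_mul (hY.holomorphic 1 1)).fun_sub
      ((hY.holomorphic 0 1).fun_mul (hY.holomorphic 1 0))
  have hG : DifferentiableOn ℂ G univ :=
    differentiableOn_extendFrom_compl_sphere_of_isLittleO one_ne_zero isOpen_univ hS
      (hd.mono fun _ hz => hz.2) (fun t ht htS => hY.exists_tendsto_det ⟨ht.2, htS⟩)
      fun t _ htS => hY.isLittleO_det htS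
  have hGdet : EqOn G (fun z => (Y z).det) circᶜ :=
    eqOn_extendFrom_of_dense (dense_compl_sphere 0 1) isClosed_sphere.isOpen_compl hd.continuousOn
  have hlim : Tendsto G (cocompact ℂ) (𝓝 1) := by
    rw [← cobounded_eq_cocompact]
    refine hY.tendsto_det_cobounded.congr' ?_
    filter_upwards [Bornology.isBounded_def.1 isBounded_sphere] with w hw
      using (hGdet hw).symm
  exact (hGdet hz).symm.trans
    ((differentiableOn_univ.1 hG).apply_eq_of_tendsto_cocompact z hlim)

theorem isUnit (hY : IsRHSolution n ν S Y) (hS : S.Finite) (hz : z ∉ circ) : IsUnit (Y z) := by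
  simp [Matrix.isUnit_iff_isUnit_det, hY.det_eq_one hS hz]

end IsRHSolution

/-- The analytic continuation across the unit circle of the solution `Y` inside the disk: outside
the disk, the jump is undone by the holomorphic weight. -/
noncomputable def continuation (n : ℕ) (ν : ℂ → ℂ) (Y : ℂ → Matrix (Fin 2) (Fin 2) ℂ) :
    ℂ → Matrix (Fin 2) (Fin 2) ℂ :=
  extendFrom circᶜ fun z => Y z * !![1, exteriorWeight n ν z; 0, 1]

namespace IsRHSolution

theorem exists_tendsto_mul_exteriorWeight (hY : IsRHSolution n ν S Y) (ht : t ∈ circ \ S)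
    (hνt : ContinuousAt (fun z => ν z / z ^ n) t) :
    ∃ B, Tendsto (fun z => Y z * !![1, exteriorWeight n ν z; 0, 1]) (𝓝[circᶜ] t) (𝓝 B) := by
  obtain ⟨Yp, Ym, -, -, hjump⟩ := hY.jump
  obtain ⟨hp, hm, hpm⟩ := hjump t ht
  have hJ : Tendsto (fun z => !![1, ν z / z ^ n; 0, 1]) (𝓝 t) (𝓝 !![1, ν t / t ^ n; 0, 1]) := by
    refine tendsto_pi_nhds.2 fun i => tendsto_pi_nhds.2 fun j => ?_
    fin_cases i <;> fin_cases j <;> simp [hνt.tendsto]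
  rw [nhdsWithin_compl_circ]
  refine ⟨Yp t, (hp.congr' ?_).sup ?_⟩
  · filter_upwards [self_mem_nhdsWithin] with z hz
    rw [exteriorWeight, if_pos hz, ← Matrix.one_fin_two, mul_one]
  · rw [hpm]
    refine (hm.mul (hJ.mono_left nhdsWithin_le_nhds)).congr' ?_
    filter_upwards [self_mem_nhdsWithin] with z hz
    rw [exteriorWeight, if_neg (lt_asymm hz)]

theorem differentiableOn_mul_exteriorWeight (hY : IsRHSolution n ν S Y)
    (hν : IsGeneralizedSemiclassical A q ν Ω) :
    DifferentiableOn ℂ (fun z => Y z * !![1, exteriorWeight n ν z; 0, 1]) (Ω \ circ) :=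
  (hY.differentiableOn.mono fun _ hz => hz.2).fun_mul fun _ hz =>
    (hasDerivAt_upperUnipotent
      (hν.hasDerivAt_exteriorWeight n hz.1 hz.2)).differentiableAt.differentiableWithinAt

theorem differentiableOn_continuation (hY : IsRHSolution n ν S Y)
    (hν : IsGeneralizedSemiclassical A q ν Ω) (hSΩ : Disjoint S Ω) :
    DifferentiableOn ℂ (continuation n ν Y) Ω :=
  differentiableOn_extendFrom_compl_sphere one_ne_zero hν.isOpen
    (hY.differentiableOn_mul_exteriorWeight hν) fun _ ht =>
      hY.exists_tendsto_mul_exteriorWeight ⟨ht.2, hSΩ.notMem_of_mem_right ht.1⟩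
        (hν.differentiableAt_div_pow n ht.1).continuousAt

theorem eqOn_continuation (hY : IsRHSolution n ν S Y)
    (hν : IsGeneralizedSemiclassical A q ν Ω) :
    EqOn (continuation n ν Y) (fun z => Y z * !![1, exteriorWeight n ν z; 0, 1]) (Ω \ circ) :=
  eqOn_extendFrom_of_dense (dense_compl_sphere 0 1) (hν.isOpen.sdiff isClosed_sphere)
    (hY.differentiableOn_mul_exteriorWeight hν).continuousOn

theorem isUnit_continuation (hY : IsRHSolution n ν S Y)
    (hν : IsGeneralizedSemiclassical A q ν Ω) (hS : S.Finite) (hSΩ : Disjoint S Ω) (hz : z ∈ Ω) :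
    IsUnit (continuation n ν Y z) := by
  have hcont : ContinuousAt (fun w => (continuation n ν Y w).det) z :=
    continuous_id.matrix_det.continuousAt.comp
      ((hY.differentiableOn_continuation hν hSΩ).continuousOn.continuousAt
        (hν.isOpen.mem_nhds hz))
  have hone : ∀ᶠ w in 𝓝[circᶜ] z, (continuation n ν Y w).det = 1 := by
    filter_upwards [self_mem_nhdsWithin, mem_nhdsWithin_of_mem_nhds (hν.isOpen.mem_nhds hz)]
      with w hwc hwΩ
    rw [hY.eqOn_continuation hν ⟨hwΩ, hwc⟩, Matrix.det_mul, hY.det_eq_one hS hwc]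
    simp
  have : (𝓝[circᶜ] z).NeBot := mem_closure_iff_nhdsWithin_neBot.1 (dense_compl_sphere 0 1 z)
  have hdet : (continuation n ν Y z).det = 1 := tendsto_nhds_unique_of_eventuallyEq
    (hcont.tendsto.mono_left nhdsWithin_le_nhds) tendsto_const_nhds hone
  simp [Matrix.isUnit_iff_isUnit_det, hdet]

end IsRHSolution

/-- The structure matrix `Z' Z⁻¹` of `Z = Y C_n`, written without the square roots that enter in
`C_n`: by the Pearson equation `C_n' C_n⁻¹` is half of `weightLogDeriv` times the third Pauli
matrix, whatever the branches. -/
noncomputable def structureMatrix (A : Polynomial ℂ) (q : ℂ → ℂ) (n : ℕ)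
    (Y : ℂ → Matrix (Fin 2) (Fin 2) ℂ) (z : ℂ) : Matrix (Fin 2) (Fin 2) ℂ :=
  gaugeTransform Y z ((weightLogDeriv A q n z / 2) • sigmaThree)

theorem differentiableAt_structureMatrix (hY : AnalyticAt ℂ Y z) (hYu : IsUnit (Y z))
    (hq : DifferentiableAt ℂ q z) (n : ℕ) (hz : z ∉ zeroSet A) :
    DifferentiableAt ℂ (structureMatrix A q n Y) z :=
  differentiableAt_gaugeTransform hY hYu
    (((differentiableAt_weightLogDeriv hq n hz).div_const 2).smul_const sigmaThree)

namespace IsRHSolution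

theorem structureMatrix_continuation (hY : IsRHSolution n ν S Y)
    (hν : IsGeneralizedSemiclassical A q ν Ω) (hz : z ∈ Ω \ circ) :
    structureMatrix A q n (continuation n ν Y) z = structureMatrix A q n Y z := by
  have hh := hν.hasDerivAt_exteriorWeight n hz.1 hz.2
  have hEq := (hY.eqOn_continuation hν).eventuallyEq_of_mem
    ((hν.isOpen.sdiff isClosed_sphere).mem_nhds hz)
  rw [structureMatrix, gaugeTransform_congr hEq,
    gaugeTransform_mul (hY.differentiableAt hz.2)
      (hasDerivAt_upperUnipotent hh).differentiableAt (isUnit_upperUnipotent _),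
    gaugeTransform_upperUnipotent hh, structureMatrix]

theorem differentiableOn_structureMatrix (hY : IsRHSolution n ν S Y) (hS : S.Finite)
    (hq : Differentiable ℂ q) :
    DifferentiableOn ℂ (structureMatrix A q n Y) ((zeroSet A)ᶜ \ circ) := fun z hz =>
  (differentiableAt_structureMatrix (hY.analyticAt hz.2) (hY.isUnit hS hz.2) (hq z) n
    hz.1).differentiableWithinAt

theorem eqOn_extendFrom_structureMatrix (hY : IsRHSolution n ν S Y) (hS : S.Finite)
    (hA : A ≠ 0) (hq : Differentiable ℂ q) :
    EqOn (extendFrom circᶜ (structureMatrix A q n Y)) (structureMatrix A q n Y)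
      ((zeroSet A)ᶜ \ circ) :=
  eqOn_extendFrom_of_dense (dense_compl_sphere 0 1)
    ((zeroSet_finite hA).isClosed.isOpen_compl.sdiff isClosed_sphere)
    (hY.differentiableOn_structureMatrix hS hq).continuousOn

theorem exists_tendsto_structureMatrix (hY : IsRHSolution n ν S Y)
    (hν : IsGeneralizedSemiclassical A q ν Ω) (hS : S.Finite) (hSΩ : Disjoint S Ω) (ht : t ∈ Ω) :
    ∃ B, Tendsto (structureMatrix A q n Y) (𝓝[circᶜ] t) (𝓝 B) := by
  have hcont : ContinuousAt (structureMatrix A q n (continuation n ν Y)) t :=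
    (differentiableAt_structureMatrix
      ((hY.differentiableOn_continuation hν hSΩ).analyticAt (hν.isOpen.mem_nhds ht))
      (hY.isUnit_continuation hν hS hSΩ ht) (hν.entire t) n (hν.subset_compl ht)).continuousAt
  refine ⟨_, (hcont.tendsto.mono_left nhdsWithin_le_nhds).congr' ?_⟩
  filter_upwards [self_mem_nhdsWithin, mem_nhdsWithin_of_mem_nhds (hν.isOpen.mem_nhds ht)]
    with z hzc hzΩ using hY.structureMatrix_continuation hν ⟨hzΩ, hzc⟩

theorem differentiableOn_extendFrom_structureMatrix (hY : IsRHSolution n ν S Y)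
    (hν : IsGeneralizedSemiclassical A q ν Ω) (hS : S.Finite) (hSΩ : Disjoint S Ω) :
    DifferentiableOn ℂ (extendFrom circᶜ (structureMatrix A q n Y)) (zeroSet A)ᶜ :=
  differentiableOn_extendFrom_compl_sphere one_ne_zero
    (zeroSet_finite hν.ne_zero).isClosed.isOpen_compl
    (hY.differentiableOn_structureMatrix hS hν.entire) fun _ ht =>
      hY.exists_tendsto_structureMatrix hν hS hSΩ (hν.circ_subset ⟨ht.2, ht.1⟩)

end IsRHSolution

section ZMatrix

variable {r s : ℂ → ℂ}

theorem zMatrix_eq_mul_diagonal_inv (n : ℕ) (Y : ℂ → Matrix (Fin 2) (Fin 2) ℂ) (r s : ℂ → ℂ) :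
    zMatrix n Y r s =
      fun w => Y w * !![(r w ^ n)⁻¹ / (s w)⁻¹, 0; 0, ((r w ^ n)⁻¹ / (s w)⁻¹)⁻¹] := by
  funext w
  rw [zMatrix, cMatrix, inv_div_inv, inv_div]

theorem isSqrtBranchAt_div_pow (hr : IsSqrtBranchAt (fun w => w) r z) (hs : IsSqrtBranchAt ν s z)
    (hz : z ≠ 0) (hνz : ν z ≠ 0) (n : ℕ) :
    IsSqrtBranchAt (fun w => ν w / w ^ n) (fun w => (r w ^ n)⁻¹ / (s w)⁻¹) z := by
  have hr0 : r z ^ n ≠ 0 := pow_ne_zero n (hr.ne_zero hz)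
  have hs0 : s z ≠ 0 := hs.ne_zero hνz
  refine ⟨((hr.1.fun_pow n).fun_inv hr0).fun_div (hs.1.fun_inv hs0) (inv_ne_zero hs0), ?_⟩
  filter_upwards [hr.2, hs.2] with w hrw hsw
  rw [div_inv_eq_mul, mul_pow, inv_pow, ← pow_mul, mul_comm n 2, pow_mul, hrw, hsw, mul_comm,
    div_eq_mul_inv]

theorem differentiableAt_zMatrix (hY : DifferentiableAt ℂ Y z) (hr : DifferentiableAt ℂ r z)
    (hr0 : r z ≠ 0) (hs : DifferentiableAt ℂ s z) (hs0 : s z ≠ 0) :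
    DifferentiableAt ℂ (zMatrix n Y r s) z := by
  have hα : DifferentiableAt ℂ (fun w => (r w ^ n)⁻¹ / (s w)⁻¹) z :=
    ((hr.fun_pow n).fun_inv (pow_ne_zero n hr0)).fun_div (hs.fun_inv hs0) (inv_ne_zero hs0)
  rw [zMatrix_eq_mul_diagonal_inv]
  exact hY.fun_mul (hasDerivAt_diagonal_inv hα.hasDerivAt (by simp [hr0, hs0])).differentiableAt

theorem isUnit_zMatrix (hY : IsUnit (Y z)) (hr : r z ≠ 0) (hs : s z ≠ 0) :
    IsUnit (zMatrix n Y r s z) := by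
  rw [zMatrix_eq_mul_diagonal_inv]
  exact hY.mul (isUnit_diagonal_inv (by simp [hr, hs]))

theorem matDeriv_zMatrix_mul_inv (hν : IsGeneralizedSemiclassical A q ν Ω) (hz : z ∈ Ω)
    (hY : DifferentiableAt ℂ Y z) (hr : IsSqrtBranchAt (fun w => w) r z)
    (hs : IsSqrtBranchAt ν s z) :
    matDeriv (zMatrix n Y r s) z * (zMatrix n Y r s z)⁻¹ = structureMatrix A q n Y z := by
  have hr0 := hr.ne_zero (hν.ne_zero_of_mem hz)
  have hs0 := hs.ne_zero (hν.weight_ne_zero z hz)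
  have hα := isSqrtBranchAt_div_pow hr hs (hν.ne_zero_of_mem hz) (hν.weight_ne_zero z hz) n
  have hα0 := hα.ne_zero (hν.div_pow_ne_zero n hz)
  have hαd := hα.1.differentiableAt
  rw [matDeriv_eq_deriv (differentiableAt_zMatrix hY hr.1.differentiableAt hr0
      hs.1.differentiableAt hs0), Matrix.nonsing_inv_eq_ringInverse, ← gaugeTransform_zero,
    zMatrix_eq_mul_diagonal_inv, gaugeTransform_mul hY
      (hasDerivAt_diagonal_inv hαd.hasDerivAt hα0).differentiableAt (isUnit_diagonal_inv hα0),
    gaugeTransform_diagonal_inv hαd hα0, hα.logDeriv_eq, hν.logDeriv_div_pow n hz, structureMatrix]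

end ZMatrix

end RiemannHilbert

end UnitCircleRH

/-- The structure matrix `M_n = Z_n' Z_n⁻¹` is holomorphic off the zeros of `z A(z)`, across the unit
circle: there is one function `M`, holomorphic on the complement of `zeroSet A`, that
equals `Z_n' Z_n⁻¹` at every point off the circle where `Z_n` is defined, whichever branches of the
square roots are used in `Z_n`. -/
theorem mainTheorem1 (A : Polynomial ℂ) (q ν : ℂ → ℂ) (Ω : Set ℂ)
    (hν : IsGeneralizedSemiclassical A q ν Ω)
    (S : Set ℂ) (hS : S ⊆ circ ∩ zeroSet A)
    (n : ℕ) (Y : ℂ → Matrix (Fin 2) (Fin 2) ℂ) (hY : IsRHSolution n ν S Y) :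
    ∃ M : ℂ → Matrix (Fin 2) (Fin 2) ℂ,
      (∀ z ∈ Ω \ circ, ∀ r s : ℂ → ℂ,
        IsSqrtBranchAt (fun w => w) r z → IsSqrtBranchAt ν s z →
          (∀ i j, DifferentiableAt ℂ (fun w => zMatrix n Y r s w i j) z) ∧
          IsUnit (zMatrix n Y r s z).det ∧
          M z = matDeriv (zMatrix n Y r s) z * (zMatrix n Y r s z)⁻¹) ∧
      (∀ i j, DifferentiableOn ℂ (fun z => M z i j) (zeroSet A)ᶜ) ∧
      (∀ a ∈ zeroSet A, ∀ᶠ z in 𝓝[≠] a, ∀ i j, DifferentiableAt ℂ (fun w => M w i j) z) := by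
  have hfin : (zeroSet A).Finite := zeroSet_finite hν.ne_zero
  have hSfin : S.Finite := hfin.subset fun _ hz => (hS hz).2
  have hSΩ : Disjoint S Ω :=
    Set.disjoint_left.2 fun _ hz hzΩ => hν.subset_compl hzΩ (hS hz).2
  have hM := differentiableOn_matrix_iff.1
    (hY.differentiableOn_extendFrom_structureMatrix hν hSfin hSΩ)
  refine ⟨extendFrom circᶜ (structureMatrix A q n Y), ?_, hM, fun a _ => ?_⟩
  · rintro z ⟨hzΩ, hzc⟩ r s hr hs
    have hYz := hY.differentiableAt hzc
    have hr0 := hr.ne_zero (hν.ne_zero_of_mem hzΩ)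
    have hs0 := hs.ne_zero (hν.weight_ne_zero z hzΩ)
    refine ⟨differentiableAt_matrix_iff.1 (differentiableAt_zMatrix hYz hr.1.differentiableAt hr0
      hs.1.differentiableAt hs0), (Matrix.isUnit_iff_isUnit_det _).1
      (isUnit_zMatrix (hY.isUnit hSfin hzc) hr0 hs0), ?_⟩
    rw [matDeriv_zMatrix_mul_inv hν hzΩ hYz hr hs]
    exact hY.eqOn_extendFrom_structureMatrix hSfin hν.ne_zero hν.entire
      ⟨hν.subset_compl hzΩ, hzc⟩
  · filter_upwards [nhdsNE_le_cofinite a hfin.compl_mem_cofinite] with z hz i j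
    exact (hM i j).differentiableAt (hfin.isClosed.isOpen_compl.mem_nhds hz)
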